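/- A finite monoid presentation is given by a number $n\ge 0$ of generators $0,1,\dots,n-1$, forming the alphabet $\mathscr{A}$, and a list of the finitely many elements of a set $\mathscr{R}$ of pairs of words over $\mathscr{A}$ (the relations). It is encoded as a string over a fixed finite alphabet in the obvious way, with generators and the number $n$ written in binary. A \emph{relation word} is a word that is a side of some relation. A \emph{piece} is a word that is empty, or is a factor of two distinct relation words, or occurs in two different (possibly overlapping) places in one relation word. The presentation is $C(4)$ if no relation word is a product of strictly fewer than $4$ pieces, and it is an \emph{equivalence presentation} if $\mathscr{R}$ is an equivalence relation on the set of relation words. \textbf{Corollary.} There is a Turing machine which halts on (the encoding of) every finite monoid presentation $\langle\mathscr{A}\mid\mathscr{R}\rangle$ after a number of steps bounded by a polynomial in the length of the input, outputs three yes/no answers, and has the following properties. (i) If $\langle\mathscr{A}\mid\mathscr{R}\rangle$ is a $C(4)$ equivalence presentation, then the three answers say, respectively, whether the monoid presented is left cancellative, whether it is right cancellative, and whether it is cancellative. (ii) For every finite presentation $\langle\mathscr{A}\mid\mathscr{R}\rangle$, the first answer is `yes' if and only if $\mathscr{R}$ contains no relation of the form $(ar,as)$ with $a\in\mathscr{A}$,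 $r,s\in\mathscr{A}^*$ and $r\neq s$; the second is `yes' if and only if $\mathscr{R}$ contains no relation of the form $(ra,sa)$ with $a\in\mathscr{A}$, $r,s\in\mathscr{A}^*$ and $r\neq s$; and the third is `yes' if and only if both of these conditions hold. -/

import Mathlib

namespace SmallOverlap

section Presentations

variable {α : Type*}

/-- A relation word of the monoid presentation with generators `α` and relations `R`: a word that
occurs as a side of some relation. -/
def IsRelationWord (R : FreeMonoid α → FreeMonoid α → Prop) (w : FreeMonoid α) : Prop :=
  ∃ v, R w v ∨ R v w

/-- A piece: the empty word, or a word that occurs as a factor of two distinct relation words, or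
in two different (possibly overlapping) places of one relation word. The prefixes `a` and `c`
record the places of the two occurrences. -/
def IsPiece (R : FreeMonoid α → FreeMonoid α → Prop) (p : FreeMonoid α) : Prop :=
  p = 1 ∨ ∃ u v a b c d : FreeMonoid α,
    IsRelationWord R u ∧ IsRelationWord R v ∧ u = a * p * b ∧ v = c * p * d ∧
      (u ≠ v ∨ a.length ≠ c.length)

/-- The small overlap condition `C(n)`: no relation word is a product of strictly fewer than `n`
pieces. -/
def IsC (n : ℕ) (R : FreeMonoid α → FreeMonoid α → Prop) : Prop :=
  ∀ l : List (FreeMonoid α), (∀ p ∈ l, IsPiece R p) → l.length < n → ¬ IsRelationWord R l.prod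

/-- An equivalence presentation: the relations form an equivalence relation on the set of relation
words. -/
def IsEquivalencePresentation (R : FreeMonoid α → FreeMonoid α → Prop) : Prop :=
  Equivalence fun u v : {w : FreeMonoid α // IsRelationWord R w} => R u v

/-- There is no relation `(a r, a s)` with `a` a letter and `r ≠ s`. -/
def NoCommonFirstLetter (R : FreeMonoid α → FreeMonoid α → Prop) : Prop :=
  ∀ (a : α) (r s : FreeMonoid α), R (.of a * r) (.of a * s) → r = s

/-- There is no relation `(r a, s a)` with `a` a letter and `r ≠ s`. -/
def NoCommonLastLetter (R : FreeMonoid α → FreeMonoid α → Prop) : Prop :=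
  ∀ (a : α) (r s : FreeMonoid α), R (r * .of a) (s * .of a) → r = s

end Presentations

/-- A finite monoid presentation as the input of an algorithm: the generators are
`0, 1, …, size - 1`, and the finite set of relations is given by listing its elements (in any order,
repetitions being allowed). -/
structure FinPresentation where
  size : ℕ
  relations : List (FreeMonoid (Fin size) × FreeMonoid (Fin size))

namespace FinPresentation

/-- The set of relations, as a binary relation on words. -/
def Rel (P : FinPresentation) (u v : FreeMonoid (Fin P.size)) : Prop :=
  (u, v) ∈ P.relations

/-- The monoid presented. -/
abbrev PresentedBy (P : FinPresentation) : Type :=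
  PresentedMonoid P.Rel

end FinPresentation

section Encodings

open Computability

/-- A natural number as its binary digits, followed by a comma. -/
def encodeNumber (n : ℕ) : List Γ' :=
  (encodeNat n).map Γ'.bit ++ [Γ'.comma]

/-- A word as the sequence of its letters (each in binary), between an opening and a closing
bracket. -/
def encodeWord {n : ℕ} (w : FreeMonoid (Fin n)) : List Γ' :=
  Γ'.bra :: (w.toList.flatMap fun a : Fin n => encodeNumber a) ++ [Γ'.ket]

/-- A relation as its left-hand side followed by its right-hand side. -/
def encodeRelation {n : ℕ} (r : FreeMonoid (Fin n) × FreeMonoid (Fin n)) : List Γ' :=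
  encodeWord r.1 ++ encodeWord r.2

/-- A finite presentation as a string over a fixed finite alphabet: the number of generators,
followed by the relations. -/
def encodePresentation (P : FinPresentation) : List Γ' :=
  encodeNumber P.size ++ P.relations.flatMap encodeRelation

/-- Three yes/no answers as a string of three bits. -/
def encodeAnswers (b : Bool × Bool × Bool) : List Bool :=
  [b.1, b.2.1, b.2.2]

theorem map_bit_append_comma_inj : ∀ {k l : List Bool} {x y : List Γ'},
    k.map Γ'.bit ++ Γ'.comma :: x = l.map Γ'.bit ++ Γ'.comma :: y → k = l ∧ x = y
  | [], [], _, _, h => by simpa using h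
  | [], _ :: _, _, _, h => by simp at h
  | _ :: _, [], _, _, h => by simp at h
  | a :: k, b :: l, x, y, h => by
    simp only [List.map_cons, List.cons_append, List.cons.injEq, Γ'.bit.injEq] at h
    obtain ⟨h1, h2⟩ := map_bit_append_comma_inj h.2
    exact ⟨by rw [h.1, h1], h2⟩

theorem encodeNumber_append_inj {m n : ℕ} {x y : List Γ'}
    (h : encodeNumber m ++ x = encodeNumber n ++ y) : m = n ∧ x = y := by
  simp only [encodeNumber, List.append_assoc, List.singleton_append] at h
  obtain ⟨h1, h2⟩ := map_bit_append_comma_inj h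
  exact ⟨by simpa using congrArg decodeNat h1, h2⟩

theorem encodeNumber_append_ne_ket {m : ℕ} {x y : List Γ'} :
    encodeNumber m ++ x ≠ Γ'.ket :: y := by
  intro h
  rcases hm : encodeNat m with _ | ⟨b, l⟩ <;> simp [encodeNumber, hm] at h

theorem encodeLetters_append_inj {n : ℕ} : ∀ {u v : List (Fin n)} {x y : List Γ'},
    (u.flatMap fun a : Fin n => encodeNumber a) ++ Γ'.ket :: x =
      (v.flatMap fun a : Fin n => encodeNumber a) ++ Γ'.ket :: y → u = v ∧ x = y
  | [], [], _, _, h => by simpa using h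
  | [], b :: v, x, y, h => by
    simp only [List.flatMap_nil, List.nil_append, List.flatMap_cons, List.append_assoc] at h
    exact (encodeNumber_append_ne_ket h.symm).elim
  | a :: u, [], x, y, h => by
    simp only [List.flatMap_nil, List.nil_append, List.flatMap_cons, List.append_assoc] at h
    exact (encodeNumber_append_ne_ket h).elim
  | a :: u, b :: v, x, y, h => by
    simp only [List.flatMap_cons, List.append_assoc] at h
    obtain ⟨h1, h2⟩ := encodeNumber_append_inj h
    obtain ⟨h3, h4⟩ := encodeLetters_append_inj h2
    exact ⟨by rw [Fin.ext h1, h3], h4⟩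

theorem encodeWord_append_inj {n : ℕ} {u v : FreeMonoid (Fin n)} {x y : List Γ'}
    (h : encodeWord u ++ x = encodeWord v ++ y) : u = v ∧ x = y := by
  simp only [encodeWord, List.cons_append, List.append_assoc, List.nil_append,
    List.cons.injEq, true_and] at h
  obtain ⟨h1, h2⟩ := encodeLetters_append_inj h
  exact ⟨FreeMonoid.toList.injective h1, h2⟩

theorem encodeRelations_inj {n : ℕ} :
    ∀ {k l : List (FreeMonoid (Fin n) × FreeMonoid (Fin n))},
      k.flatMap encodeRelation = l.flatMap encodeRelation → k = l
  | [], [], _ => rfl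
  | [], _ :: _, h => by simp [encodeRelation, encodeWord] at h
  | _ :: _, [], h => by simp [encodeRelation, encodeWord] at h
  | a :: k, b :: l, h => by
    simp only [List.flatMap_cons, encodeRelation, List.append_assoc] at h
    obtain ⟨h1, h2⟩ := encodeWord_append_inj h
    obtain ⟨h3, h4⟩ := encodeWord_append_inj h2
    rw [Prod.ext h1 h3, encodeRelations_inj h4]

/-- A presentation can be recovered from its encoding. -/
theorem encodePresentation_injective : Function.Injective encodePresentation := by
  rintro ⟨m, k⟩ ⟨n, l⟩ h
  obtain ⟨h1, h2⟩ := encodeNumber_append_inj h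
  obtain rfl : m = n := h1
  exact congrArg _ (encodeRelations_inj h2)

end Encodings

end SmallOverlap

/-! If `(ar, as)` is a relation and the monoid is left cancellative, then `r` and `s` represent the
same element. A relation word lying inside another one after a nonempty prefix would be a piece, so
nothing in `r` can be rewritten, and `r = s` as words (`Deriv.eq_of_suffix`).

Conversely, `Deriv.cancel_letter` removes the letter `a` from a derivation of `ay` from `ax`, by
induction on its length. If no step touches the first letter, that letter can be dropped. Otherwise
let `(au, v)` be the relation of the first step that does. If the first letter is not touched again,
then `v` begins with `a`, so `v = au` by hypothesis and the step was void. If it is touched again,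
write `v = PZ` with `Z` its longest piece suffix. The steps in between cannot alter `P`
(`Deriv.interior`), and `P` determines `v`, so the next step at the front rewrites `v` itself. By
induction the tail behind `v` is rewritten without using `Z`, and transitivity of the relations
merges the two steps at the front into one, which shortens the derivation. What protects `P` is
`PrefixForm.no_overlap`, where the full strength of three pieces is needed. The right-hand case
follows by reversing all words.

Letters are binary numbers of unbounded size, so a finite control cannot store one. It can, however,
compare two encoded words symbol by symbol, recording whether they agree throughout and whether they
agree up to the end of the first letter. Moving a word between stacks reverses it, so one comparison
treats last letters and the next treats first letters, in linear time. -/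

namespace SmallOverlap

/-! ### Pieces and the cancellation of letters in derivations. -/

section Cancellation

variable {α : Type*} {R : List α → List α → Prop}

/-- No relation word is a product of at most three pieces (as the empty word is a piece, of exactly
three pieces). -/
def NoThreePieces (R : List α → List α → Prop) : Prop :=
  ∀ p q r : List α, IsPiece (α := α) R p → IsPiece (α := α) R q → IsPiece (α := α) R r →
    ¬ IsRelationWord (α := α) R (p ++ q ++ r)

theorem IsPiece.nil : IsPiece (α := α) R ([] : List α) := Or.inl rfl

theorem isPiece_of_occurrences {u v p : List α} (a b c d : List α)
    (hu : IsRelationWord (α := α) R u) (hv : IsRelationWord (α := α) R v)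
    (hu' : u = a ++ p ++ b) (hv' : v = c ++ p ++ d) (h : u ≠ v ∨ a.length ≠ c.length) :
    IsPiece (α := α) R p :=
  Or.inr ⟨u, v, a, b, c, d, hu, hv, hu', hv', h⟩

theorem IsPiece.of_append {p q : List α} (h : IsPiece (α := α) R (p ++ q)) :
    IsPiece (α := α) R p := by
  rcases h with h | ⟨u, v, a, b, c, d, hu, hv, hu', hv', h⟩
  · exact Or.inl (List.append_eq_nil_iff.1 h).1
  · have assoc : ∀ a b : List α, a ++ (p ++ q) ++ b = a ++ p ++ (q ++ b) := by simp
    exact isPiece_of_occurrences a (List.append q b) c (List.append q d) hu hv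
      (hu'.trans (assoc a b)) (hv'.trans (assoc c d)) h

namespace NoThreePieces

variable (hC : NoThreePieces R)
include hC

theorem not_isPiece {w : List α} (hw : IsRelationWord (α := α) R w) : ¬ IsPiece (α := α) R w :=
  fun h => hC w [] [] h .nil .nil (by simpa using hw)

theorem ne_nil {w : List α} (hw : IsRelationWord (α := α) R w) : w ≠ [] := by
  rintro rfl
  exact hC.not_isPiece hw .nil

/-- A relation word is not a factor of a relation word, except for being that word. -/
theorem not_inner {u w a b : List α} (hu : IsRelationWord (α := α) R u)
    (hw : IsRelationWord (α := α) R w) (h : u = a ++ w ++ b) (ha : a ≠ []) : False := by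
  refine hC.not_isPiece hw (isPiece_of_occurrences a b [] [] hu hw h (by simp) (Or.inr ?_))
  simpa using ha

end NoThreePieces

/-- `Z` is the longest suffix of the relation word `u = P ++ Z` that is a piece. -/
structure IsMaxSplit (R : List α → List α → Prop) (u P Z : List α) : Prop where
  relationWord : IsRelationWord (α := α) R u
  eq_append : u = P ++ Z
  isPiece : IsPiece (α := α) R Z
  maximal : ∀ p q : List α, P = p ++ q → q ≠ [] → ¬ IsPiece (α := α) R (q ++ Z)

/-- The empty suffix is a piece, so there is a least index from which the remaining suffix is one.
-/
theorem exists_isMaxSplit {u : List α} (hu : IsRelationWord (α := α) R u) :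
    ∃ P Z, IsMaxSplit R u P Z := by
  classical
  have hex : ∃ i, IsPiece (α := α) R (u.drop i) := ⟨u.length, by simpa using IsPiece.nil⟩
  have hle : Nat.find hex ≤ u.length := Nat.find_min' hex (by simpa using IsPiece.nil)
  refine ⟨u.take (Nat.find hex), u.drop (Nat.find hex), hu, by simp, Nat.find_spec hex, ?_⟩
  intro p q hpq hq h
  have hlen : p.length + q.length = Nat.find hex := by
    have := congrArg List.length hpq
    simp only [List.length_take, List.length_append] at this
    omega
  have hlt : p.length < Nat.find hex := by
    have := List.length_pos_iff.2 hq
    omega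
  refine Nat.find_min hex hlt ?_
  have : u = p ++ (q ++ u.drop (Nat.find hex)) := by
    rw [← List.append_assoc, ← hpq, List.take_append_drop]
  have h2 : u.drop p.length = q ++ u.drop (Nat.find hex) := by
    conv_lhs => rw [this]
    simp
  rwa [h2]

/-- Otherwise `u` would be a product of two pieces. Consequently `P` occurs in only one relation
word, and at only one place there. -/
theorem IsMaxSplit.not_isPiece_left (hC : NoThreePieces R) {u P Z : List α}
    (h : IsMaxSplit R u P Z) : ¬ IsPiece (α := α) R P := fun hP =>
  hC P Z [] hP h.isPiece .nil (by simpa [← h.eq_append] using h.relationWord)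

theorem IsMaxSplit.left_ne_nil (hC : NoThreePieces R) {u P Z : List α}
    (h : IsMaxSplit R u P Z) : P ≠ [] := by
  rintro rfl
  exact h.not_isPiece_left hC .nil

/-- Two relation words that start one word cannot differ, if one of them is only known up to its
longest piece suffix. -/
theorem IsMaxSplit.eq_of_append_eq (hC : NoThreePieces R) {u P Z w s t : List α}
    (h : IsMaxSplit R u P Z) (hw : IsRelationWord (α := α) R w) (e : w ++ s = P ++ t) : w = u := by
  by_contra hne
  rcases List.append_eq_append_iff.1 e with ⟨c, hc, -⟩ | ⟨c, hc, -⟩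
  · refine hC.not_isPiece hw (isPiece_of_occurrences [] [] [] (c ++ Z) hw h.relationWord
      (by simp) ?_ (Or.inl hne))
    simp [h.eq_append, hc]
  · refine h.not_isPiece_left hC (isPiece_of_occurrences [] c [] Z hw h.relationWord
      (by simp [hc]) (by simp [h.eq_append]) (Or.inl hne))

/-- Rewriting one factor of a word by a relation. -/
def Step (R : List α → List α → Prop) (w w' : List α) : Prop :=
  ∃ x u v y, R u v ∧ w = x ++ u ++ y ∧ w' = x ++ v ++ y

/-- Derivations, with their number of steps. -/
inductive Deriv (R : List α → List α → Prop) : ℕ → List α → List α → Prop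
  | refl (w : List α) : Deriv R 0 w w
  | tail {n : ℕ} {u v w : List α} : Deriv R n u v → Step R v w → Deriv R (n + 1) u w

theorem Deriv.trans {m n : ℕ} {u v w : List α} (h : Deriv R m u v) (h' : Deriv R n v w) :
    Deriv R (m + n) u w := by
  induction h' with
  | refl => exact h
  | tail _ hs ih => exact .tail (ih h) hs

theorem Step.append_left {u v : List α} (p : List α) (h : Step R u v) :
    Step R (p ++ u) (p ++ v) := by
  obtain ⟨x, a, b, y, hab, rfl, rfl⟩ := h
  exact ⟨p ++ x, a, b, y, hab, by simp, by simp⟩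

theorem Step.append_right {u v : List α} (p : List α) (h : Step R u v) :
    Step R (u ++ p) (v ++ p) := by
  obtain ⟨x, a, b, y, hab, rfl, rfl⟩ := h
  exact ⟨x, a, b, y ++ p, hab, by simp, by simp⟩

theorem Deriv.append_left {n : ℕ} {u v : List α} (p : List α) (h : Deriv R n u v) :
    Deriv R n (p ++ u) (p ++ v) := by
  induction h with
  | refl => exact .refl _
  | tail _ hs ih => exact .tail ih (hs.append_left p)

theorem Deriv.append_right {n : ℕ} {u v : List α} (p : List α) (h : Deriv R n u v) :
    Deriv R n (u ++ p) (v ++ p) := by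
  induction h with
  | refl => exact .refl _
  | tail _ hs ih => exact .tail ih (hs.append_right p)

/-- What a word derived in `n` steps from a word with prefix `Z` looks like: it still has this
prefix, or it has a shorter prefix of `Z` followed by a relation word, the last piece of which may
have been changed. -/
def PrefixForm (R : List α → List α → Prop) (n : ℕ) (Z z : List α) : Prop :=
  (∃ q, z = Z ++ q) ∨
    ∃ Z₁ u P Z' t r m, Z₁ <+: Z ∧ IsMaxSplit R u P Z' ∧ z = Z₁ ++ (P ++ t) ∧ m < n ∧
      Deriv R m (Z' ++ r) t

theorem PrefixForm.of_relationWord {n : ℕ} {Z Z₁ v y : List α} (h : Z₁ <+: Z)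
    (hv : IsRelationWord (α := α) R v) : PrefixForm R (n + 1) Z (Z₁ ++ v ++ y) := by
  obtain ⟨P, Z', hs⟩ := exists_isMaxSplit hv
  exact Or.inr ⟨Z₁, v, P, Z', Z' ++ y, y, 0, h, hs, by simp [hs.eq_append], by omega, .refl _⟩

/-- No relation word starts strictly inside the part `p ++ q` of a relation word. -/
theorem PrefixForm.no_overlap (hC : NoThreePieces R) {n : ℕ} {u p q Z t w y : List α}
    (hu : IsMaxSplit R u (p ++ q) Z) (hp : p ≠ []) (hq : q ≠ []) (ht : PrefixForm R n Z t)
    (hw : IsRelationWord (α := α) R w) (e : w ++ y = q ++ t) : False := by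
  rcases List.append_eq_append_iff.1 e with ⟨c, hc, -⟩ | ⟨w₂, hc, ht'⟩
  · exact hC.not_inner hu.relationWord hw (a := p) (b := c ++ Z)
      (by simp [hu.eq_append, hc]) hp
  · have hp' : p.length ≠ ([] : List α).length := by simpa using hp
    rcases ht with ⟨s, hs⟩ | ⟨Z₁, u', P, Z', t', r, m, hZ₁, hs, htt, -, -⟩
    · rw [hs] at ht'
      rcases List.append_eq_append_iff.1 ht' with ⟨c, hc', -⟩ | ⟨c, hc', -⟩
      -- Here `w` begins with `q ++ Z`, which also occurs in `u` after `p`. It is thus a piece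
      -- longer than `Z`.
      · exact hu.maximal p q rfl hq (isPiece_of_occurrences p [] [] c hu.relationWord hw
          (by simp [hu.eq_append]) (by simp [hc, hc']) (Or.inr hp'))
      · exact hC.not_inner hu.relationWord hw (a := p) (b := c)
          (by simp [hu.eq_append, hc, hc']) hp
    · obtain ⟨Z₂, rfl⟩ := hZ₁
      rw [htt] at ht'
      have hqp : IsPiece (α := α) R q := isPiece_of_occurrences p (Z₁ ++ Z₂) [] w₂
        hu.relationWord hw (by simp [hu.eq_append]) (by simp [hc]) (Or.inr hp')
      rcases List.append_eq_append_iff.1 ht' with ⟨w₃, hc', ht3⟩ | ⟨c, hc', -⟩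
      · rcases List.append_eq_append_iff.1 ht3 with ⟨c, hc3, -⟩ | ⟨c, hc3, -⟩
        · refine hs.not_isPiece_left hC (isPiece_of_occurrences [] Z' (q ++ Z₁) c
            hs.relationWord hw (by simp [hs.eq_append]) (by simp [hc, hc', hc3]) (Or.inr ?_))
          have := List.length_pos_iff.2 hq
          simp only [List.length_nil, List.length_append]
          omega
        · have h3 : IsPiece (α := α) R w₃ := by
            refine isPiece_of_occurrences [] (c ++ Z') (q ++ Z₁) [] hs.relationWord hw
              (by simp [hs.eq_append, hc3]) (by simp [hc, hc']) (Or.inr ?_)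
            have := List.length_pos_iff.2 hq
            simp only [List.length_nil, List.length_append]
            omega
          -- The only use of three pieces: `q` recurs in `u`, `Z₁` is a prefix of the piece `Z`, and
          -- `w₃` is a prefix of `u'`.
          exact hC q Z₁ w₃ hqp hu.isPiece.of_append h3 (by simpa [hc, hc'] using hw)
      · exact hC.not_inner hu.relationWord hw (a := p) (b := c ++ Z₂)
          (by simp [hu.eq_append, hc, hc']) hp

/-- Strong induction is needed because the second alternative of `PrefixForm` contains a shorter
derivation, to which the statement is applied again. -/
theorem Deriv.prefixForm (hC : NoThreePieces R) {n : ℕ} :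
    ∀ {Z q z : List α}, Deriv R n (Z ++ q) z → PrefixForm R n Z z := by
  induction n using Nat.strong_induction_on with
  | _ n ih =>
  intro Z q z h
  cases h with
  | refl => exact Or.inl ⟨q, rfl⟩
  | @tail n _ z' _ h hs =>
    obtain ⟨x, a, b, y, hab, e, rfl⟩ := hs
    have ha : IsRelationWord (α := α) R a := ⟨b, Or.inl hab⟩
    have hb : IsRelationWord (α := α) R b := ⟨a, Or.inr hab⟩
    rcases ih n (by omega) h with ⟨q', rfl⟩ | ⟨Z₁, u, P, Z', t, r, m, hZ₁, hs, rfl, hm, hd⟩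
    · rw [List.append_assoc] at e
      rcases List.append_eq_append_iff.1 e with ⟨c, rfl, -⟩ | ⟨c, rfl, -⟩
      · exact Or.inl ⟨c ++ b ++ y, by simp⟩
      · exact PrefixForm.of_relationWord (List.prefix_append _ _) hb
    · rw [List.append_assoc] at e
      rcases List.append_eq_append_iff.1 e with ⟨x', rfl, e2⟩ | ⟨c, rfl, -⟩
      · rcases List.append_eq_append_iff.1 e2 with ⟨c, rfl, e3⟩ | ⟨c, rfl, e3⟩
        -- The step takes place beyond `P`, so it only prolongs the inner derivation.
        · refine Or.inr ⟨Z₁, u, P, Z', c ++ b ++ y, r, m + 1, hZ₁, hs, by simp, by omega,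
            .tail hd ⟨c, a, b, y, hab, by simp [e3], rfl⟩⟩
        · rcases eq_or_ne x' [] with rfl | hx'
          · simpa using PrefixForm.of_relationWord (y := y) hZ₁ hb
          · rcases eq_or_ne c [] with rfl | hc
            · refine Or.inr ⟨Z₁, u, x', Z', b ++ y, r, m + 1, hZ₁, by simpa using hs, by simp,
                by omega, .tail hd ⟨[], a, b, y, hab, by simpa using e3.symm, rfl⟩⟩
            -- The rewritten word would start strictly inside `P`. The induction hypothesis for the
            -- inner derivation describes what follows `P`.
            · exact (PrefixForm.no_overlap hC hs hx' hc (ih m (by omega) hd) ha e3).elim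
      · exact PrefixForm.of_relationWord ((List.prefix_append _ _).trans hZ₁) hb

/-- The interior part of a relation word is not touched by derivations that spare its first
letter. -/
theorem Deriv.interior (hC : NoThreePieces R) {v P Z q : List α} {b : α}
    (hv : IsMaxSplit R v (b :: P) Z) {n : ℕ} {s : List α} (h : Deriv R n (P ++ (Z ++ q)) s) :
    ∃ z, s = P ++ z ∧ Deriv R n (Z ++ q) z := by
  generalize e : P ++ (Z ++ q) = s₀ at h
  induction h with
  | refl => exact ⟨_, e.symm, .refl _⟩
  | tail h hs ih =>
    obtain ⟨z, rfl, hz⟩ := ih e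
    obtain ⟨x, a, c, y, hac, e, rfl⟩ := hs
    rw [List.append_assoc] at e
    rcases List.append_eq_append_iff.1 e with ⟨d, rfl, e3⟩ | ⟨d, rfl, e3⟩
    · exact ⟨d ++ c ++ y, by simp, .tail hz ⟨d, a, c, y, hac, by simp [e3], rfl⟩⟩
    · rcases eq_or_ne d [] with rfl | hd
      · exact ⟨c ++ y, by simp, .tail hz ⟨[], a, c, y, hac, by simpa using e3.symm, rfl⟩⟩
      -- The spared letter `b` keeps the part before the overlap nonempty even if `x` is empty.
      · exact (PrefixForm.no_overlap hC (p := b :: x) hv (by simp) hd (hz.prefixForm hC)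
          ⟨c, Or.inl hac⟩ e3).elim

/-- A derivation either never touches the first letter, or there is a first step that does. -/
theorem Deriv.first_letter {a : α} {x w : List α} {n : ℕ} (hnil : ∀ v, ¬ R [] v)
    (h : Deriv R n (a :: x) w) :
    (∃ y, w = a :: y ∧ Deriv R n x y) ∨
      ∃ i j u v q, i + 1 + j = n ∧ Deriv R i x (u ++ q) ∧ R (a :: u) v ∧ Deriv R j (v ++ q) w := by
  generalize e : a :: x = w₀ at h
  induction h with
  | refl => exact Or.inl ⟨x, e.symm, .refl _⟩
  | @tail n _ _ w h hs ih =>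
    rcases ih e with ⟨y, rfl, hy⟩ | ⟨i, j, u, v, q, hij, hi, huv, hj⟩
    · obtain ⟨_ | ⟨x₀, x'⟩, c, d, z, hcd, e, rfl⟩ := hs
      · rcases c with _ | ⟨c₀, c⟩
        · exact (hnil d hcd).elim
        · simp only [List.nil_append, List.cons_append, List.cons.injEq] at e
          obtain ⟨rfl, rfl⟩ := e
          exact Or.inr ⟨n, 0, c, d, z, rfl, hy, hcd, .refl _⟩
      · simp only [List.cons_append, List.cons.injEq] at e
        obtain ⟨rfl, rfl⟩ := e
        exact Or.inl ⟨x' ++ d ++ z, rfl, .tail hy ⟨x', c, d, z, hcd, rfl, rfl⟩⟩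
    · exact Or.inr ⟨i, j + 1, u, v, q, by omega, hi, huv, .tail hj hs⟩

/-- The bound `m ≤ n` is part of the conclusion because the induction cancels the whole word `Z`
letter by letter and must still obtain a shorter derivation. -/
theorem Deriv.cancel_letter (hC : NoThreePieces R) (htrans : ∀ u v w, R u v → R v w → R u w)
    (hfirst : ∀ (a : α) (r s : List α), R (a :: r) (a :: s) → r = s) (n : ℕ) :
    ∀ (a : α) (x y : List α), Deriv R n (a :: x) (a :: y) → ∃ m ≤ n, Deriv R m x y := by
  have hnil : ∀ v, ¬ R [] v := fun v h => hC.ne_nil (w := []) ⟨v, Or.inl h⟩ rfl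
  induction n using Nat.strong_induction_on with
  | _ n ih =>
  have ihw : ∀ k < n, ∀ p x y : List α, Deriv R k (p ++ x) (p ++ y) →
      ∃ m ≤ k, Deriv R m x y := by
    intro k hk p
    induction p generalizing k with
    | nil => exact fun x y h => ⟨k, le_rfl, h⟩
    | cons a p ihp =>
      intro x y h
      obtain ⟨m, hm, h'⟩ := ih k hk a _ _ h
      obtain ⟨m', hm', h''⟩ := ihp m (by omega) x y h'
      exact ⟨m', by omega, h''⟩
  intro a x y h
  rcases h.first_letter hnil with ⟨y', e, h⟩ | ⟨i, j, u, v, q, hn, hi, huv, hj⟩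
  · obtain rfl : y = y' := (List.cons.inj e).2
    exact ⟨n, le_rfl, h⟩
  · have hv : IsRelationWord (α := α) R v := ⟨a :: u, Or.inr huv⟩
    rcases v with _ | ⟨b, s⟩
    · exact (hC.ne_nil hv rfl).elim
    rcases Deriv.first_letter hnil hj with
      ⟨y', e, h⟩ | ⟨i₂, j₂, u₂, v₂, q₂, hn₂, hi₂, huv₂, hj₂⟩
    -- The front is not touched again, so `v` begins with `a` and `hfirst` makes the step void.
    · obtain ⟨rfl, rfl⟩ := List.cons.inj e
      obtain rfl := hfirst _ _ _ huv
      exact ⟨i + j, by omega, hi.trans h⟩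
    · obtain ⟨P', Z, hs⟩ := exists_isMaxSplit hv
      rcases P' with _ | ⟨b', P⟩
      · exact (hs.left_ne_nil hC rfl).elim
      obtain ⟨rfl, rfl⟩ := List.cons.inj hs.eq_append
      simp only [List.append_eq, List.append_assoc] at *
      obtain ⟨z, hz, hZ⟩ := hi₂.interior hC hs
      -- The second front step rewrites exactly the word `v` created by the first.
      have e : b :: u₂ = b :: (P ++ Z) :=
        hs.eq_of_append_eq hC ⟨v₂, Or.inl huv₂⟩ (s := q₂) (t := z) (by simp [hz])
      obtain rfl := (List.cons.inj e).2
      rw [List.append_assoc, List.append_cancel_left_eq] at hz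
      subst hz
      obtain ⟨k, hk, hq⟩ := ihw i₂ (by omega) Z _ _ hZ
      -- The tail `q` is turned into `q₂` beforehand, so the front steps become adjacent and merge.
      -- As `k ≤ i₂`, at least one step is saved.
      have h1 : Deriv R (i + k + 1 + j₂) (a :: x) (a :: y) := by
        refine Deriv.trans (.tail ((hi.append_left [a]).trans (hq.append_left (a :: u))) ?_) hj₂
        exact ⟨[], a :: u, v₂, q₂, htrans _ _ _ huv huv₂, by simp, by simp⟩
      obtain ⟨m, hm, hxy⟩ := ih _ (by omega) a x y h1
      exact ⟨m, by omega, hxy⟩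

end Cancellation

end SmallOverlap

namespace SmallOverlap

/-! ### Reversal of words, and cancellation in the presented monoid. -/

section PresentedMonoid

variable {α : Type*}

theorem Deriv.symm {R : List α → List α → Prop} (hR : ∀ u v, R u v → R v u) {n : ℕ}
    {u v : List α} (h : Deriv R n u v) : Deriv R n v u := by
  induction h with
  | refl => exact .refl _
  | @tail n _ _ _ _ hs ih =>
    obtain ⟨x, a, b, y, hab, rfl, rfl⟩ := hs
    have := Deriv.trans (.tail (.refl _) ⟨x, b, a, y, hR _ _ hab, rfl, rfl⟩) ih
    rwa [zero_add, add_comm] at this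

/-- The presentation with all words reversed. -/
def reversedRel (R : List α → List α → Prop) (u v : List α) : Prop :=
  R u.reverse v.reverse

theorem isRelationWord_reversedRel {R : List α → List α → Prop} {w : List α}
    (h : IsRelationWord (α := α) (reversedRel R) w) : IsRelationWord (α := α) R w.reverse := by
  obtain ⟨v, h⟩ := h
  exact ⟨List.reverse v, h⟩

theorem isPiece_reversedRel {R : List α → List α → Prop} {p : List α}
    (h : IsPiece (α := α) (reversedRel R) p) : IsPiece (α := α) R p.reverse := by
  rcases h with h | ⟨u, v, a, b, c, d, hu, hv, hu', hv', h⟩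
  · obtain rfl : p = [] := h
    exact .nil
  · change List α at u v a b c d
    have rev : ∀ {w a b : List α}, w = a ++ p ++ b →
        w.reverse = b.reverse ++ p.reverse ++ a.reverse := by
      rintro w a b rfl
      simp
    refine isPiece_of_occurrences b.reverse a.reverse d.reverse c.reverse
      (isRelationWord_reversedRel hu) (isRelationWord_reversedRel hv) (rev hu') (rev hv') ?_
    by_cases huv : u = v
    -- In a single word, occurrences of `p` with prefixes of different lengths also have suffixes of
    -- different lengths.
    · right
      have hlen := h.resolve_left (not_not.2 huv)
      have e : (a ++ p ++ b : List α) = c ++ p ++ d := hu'.symm.trans (huv.trans hv')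
      have e := congrArg List.length e
      have hlen' : List.length a ≠ List.length c := hlen
      simp only [List.length_append, List.length_reverse] at e ⊢
      omega
    · exact Or.inl fun h => huv (List.reverse_injective h)

theorem NoThreePieces.reversedRel {R : List α → List α → Prop} (hC : NoThreePieces R) :
    NoThreePieces (reversedRel R) := fun p q r hp hq hr h =>
  hC r.reverse q.reverse p.reverse (isPiece_reversedRel hr) (isPiece_reversedRel hq)
    (isPiece_reversedRel hp) (by simpa using isRelationWord_reversedRel h)

theorem Deriv.reverse {R : List α → List α → Prop} {n : ℕ} {u v : List α} (h : Deriv R n u v) :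
    Deriv (reversedRel R) n u.reverse v.reverse := by
  induction h with
  | refl => exact .refl _
  | tail _ hs ih =>
    obtain ⟨x, a, b, y, hab, rfl, rfl⟩ := hs
    exact .tail ih ⟨y.reverse, a.reverse, b.reverse, x.reverse,
      by simpa [SmallOverlap.reversedRel] using hab, by simp, by simp⟩

theorem reversedRel_reversedRel (R : List α → List α → Prop) :
    reversedRel (reversedRel R) = R := by
  funext u v
  simp [reversedRel]

/-- A proper suffix of a relation word cannot be rewritten. -/
theorem Deriv.eq_of_suffix {R : List α → List α → Prop} (hC : NoThreePieces R) {n : ℕ}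
    {a r s : List α} (ha : a ≠ []) (hw : IsRelationWord (α := α) R (a ++ r))
    (h : Deriv R n r s) : r = s := by
  induction h with
  | refl => rfl
  | tail _ hs ih =>
    obtain ⟨x, u, v, y, huv, rfl, rfl⟩ := hs
    obtain rfl := ih hw
    exact (hC.not_inner hw (w := u) (a := a ++ x) (b := y) ⟨v, Or.inl huv⟩ (by simp)
      (by simp [ha])).elim

theorem Deriv.of_reverse {R : List α → List α → Prop} {n : ℕ} {u v : List α}
    (h : Deriv (reversedRel R) n u.reverse v.reverse) : Deriv R n u v := by
  simpa [reversedRel_reversedRel] using h.reverse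

/-- A proper prefix of a relation word cannot be rewritten. -/
theorem Deriv.eq_of_prefix {R : List α → List α → Prop} (hC : NoThreePieces R) {n : ℕ}
    {a r s : List α} (ha : a ≠ []) (hw : IsRelationWord (α := α) R (r ++ a))
    (h : Deriv R n r s) : r = s := by
  have hw' : IsRelationWord (α := α) (reversedRel R) (a.reverse ++ r.reverse) := by
    rw [← List.reverse_append]
    refine isRelationWord_reversedRel ?_
    rwa [reversedRel_reversedRel]
  exact List.reverse_injective (h.reverse.eq_of_suffix hC.reversedRel (by simpa using ha) hw')

theorem Deriv.cancel_letter_right {R : List α → List α → Prop} (hC : NoThreePieces R)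
    (htrans : ∀ u v w, R u v → R v w → R u w)
    (hlast : ∀ (a : α) (r s : List α), R (r ++ [a]) (s ++ [a]) → r = s) {n : ℕ}
    {a : α} {x y : List α} (h : Deriv R n (x ++ [a]) (y ++ [a])) : ∃ m ≤ n, Deriv R m x y := by
  obtain ⟨m, hm, h⟩ := Deriv.cancel_letter hC.reversedRel (fun u v w => htrans _ _ _)
    (fun a r s h => List.reverse_injective (hlast a _ _ (by simpa [reversedRel] using h))) n a
    x.reverse y.reverse (by simpa using h.reverse)
  exact ⟨m, hm, h.of_reverse⟩

variable {R : FreeMonoid α → FreeMonoid α → Prop}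

/-- Derivability is itself a congruence containing `R`. `Step` uses relations from left to right
only, so symmetry of `R` is what makes it symmetric. -/
theorem conGen_iff_deriv (hR : ∀ u v, R u v → R v u) {u v : FreeMonoid α} :
    conGen R u v ↔ ∃ n, Deriv (α := α) R n u v := by
  constructor
  · let c : Con (FreeMonoid α) :=
      { r := fun u v => ∃ n, Deriv (α := α) R n u v
        iseqv := ⟨fun u => ⟨0, .refl u⟩, fun ⟨n, h⟩ => ⟨n, h.symm hR⟩,
          fun ⟨_, h⟩ ⟨_, h'⟩ => ⟨_, h.trans h'⟩⟩
        mul' := fun ⟨_, h⟩ ⟨_, h'⟩ => ⟨_, (h.append_right _).trans (h'.append_left _)⟩ }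
    have hc : conGen R ≤ c := Con.conGen_le.2 fun u v h =>
      ⟨1, .tail (.refl u) ⟨[], u, v, [], h, (List.append_nil (as := u)).symm,
        (List.append_nil (as := v)).symm⟩⟩
    exact fun h => hc h
  · rintro ⟨n, h⟩
    induction h with
    | refl w => exact (conGen R).refl w
    | tail _ hs ih =>
      obtain ⟨x, a, b, y, hab, rfl, rfl⟩ := hs
      have hab' : conGen R a b := ConGen.Rel.of _ _ hab
      have := (conGen R).mul ((conGen R).mul ((conGen R).refl x) hab') ((conGen R).refl y)
      exact (conGen R).trans ih this

theorem IsC.noThreePieces (hC : IsC 4 R) : NoThreePieces (α := α) R := by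
  intro p q r hp hq hr h
  change FreeMonoid α at p q r
  refine hC [p, q, r] (by simp [hp, hq, hr]) (by simp) ?_
  have e : ([p, q, r] : List (FreeMonoid α)).prod = p * q * r := by simp [mul_assoc]
  exact e ▸ h

theorem IsEquivalencePresentation.symm (hE : IsEquivalencePresentation R) (u v : FreeMonoid α)
    (h : R u v) : R v u :=
  Equivalence.symm hE (x := ⟨u, v, Or.inl h⟩) (y := ⟨v, u, Or.inr h⟩) h

theorem IsEquivalencePresentation.trans (hE : IsEquivalencePresentation R)
    (u v w : FreeMonoid α) (h : R u v) (h' : R v w) : R u w :=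
  Equivalence.trans hE (x := ⟨u, v, Or.inl h⟩) (y := ⟨v, u, Or.inr h⟩) (z := ⟨w, v, Or.inr h'⟩)
    h h'

theorem isLeftCancelMul_of_letters
    (h : ∀ (a : α) (x y : FreeMonoid α), conGen R (.of a * x) (.of a * y) → conGen R x y) :
    IsLeftCancelMul (PresentedMonoid R) where
  mul_left_cancel p x y := by
    induction p using PresentedMonoid.inductionOn with | h p
    induction x using PresentedMonoid.inductionOn with | h x
    induction y using PresentedMonoid.inductionOn with | h y
    simp only [← map_mul, PresentedMonoid.mk_eq_mk_iff]
    intro e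
    induction p using FreeMonoid.recOn with
    | one => simpa using e
    | of_mul a p ih => exact ih (h a _ _ (by simpa only [mul_assoc] using e))

theorem isRightCancelMul_of_letters
    (h : ∀ (a : α) (x y : FreeMonoid α), conGen R (x * .of a) (y * .of a) → conGen R x y) :
    IsRightCancelMul (PresentedMonoid R) where
  mul_right_cancel p x y := by
    induction p using PresentedMonoid.inductionOn with | h p
    induction x using PresentedMonoid.inductionOn with | h x
    induction y using PresentedMonoid.inductionOn with | h y
    simp only [← map_mul, PresentedMonoid.mk_eq_mk_iff]
    intro e
    induction p using FreeMonoid.recOn generalizing x y with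
    | one => simpa using e
    | of_mul a p ih => exact h a _ _ (ih _ _ (by simpa only [mul_assoc] using e))

/-- Forwards, rigidity of proper suffixes of relation words turns equality in the monoid into
equality of words. Backwards, cancelling single letters suffices. -/
theorem isLeftCancelMul_iff (hC : IsC 4 R) (hE : IsEquivalencePresentation R) :
    IsLeftCancelMul (PresentedMonoid R) ↔ NoCommonFirstLetter R := by
  constructor
  · intro _ a r s h
    have e : PresentedMonoid.mk R r = PresentedMonoid.mk R s := by
      have := PresentedMonoid.mk_eq_mk_of_rel h
      rw [map_mul, map_mul] at this
      exact mul_left_cancel this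
    obtain ⟨n, hn⟩ := (conGen_iff_deriv hE.symm).1 (PresentedMonoid.mk_eq_mk_iff.1 e)
    exact hn.eq_of_suffix hC.noThreePieces (a := [a]) (by simp) ⟨_, Or.inl h⟩
  · intro h
    refine isLeftCancelMul_of_letters fun a x y hxy => ?_
    obtain ⟨n, hn⟩ := (conGen_iff_deriv hE.symm).1 hxy
    obtain ⟨m, -, hm⟩ := Deriv.cancel_letter hC.noThreePieces hE.trans h n a x y hn
    exact (conGen_iff_deriv hE.symm).2 ⟨m, hm⟩

theorem isRightCancelMul_iff (hC : IsC 4 R) (hE : IsEquivalencePresentation R) :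
    IsRightCancelMul (PresentedMonoid R) ↔ NoCommonLastLetter R := by
  constructor
  · intro _ a r s h
    have e : PresentedMonoid.mk R r = PresentedMonoid.mk R s := by
      have := PresentedMonoid.mk_eq_mk_of_rel h
      rw [map_mul, map_mul] at this
      exact mul_right_cancel this
    obtain ⟨n, hn⟩ := (conGen_iff_deriv hE.symm).1 (PresentedMonoid.mk_eq_mk_iff.1 e)
    exact hn.eq_of_prefix hC.noThreePieces (a := [a]) (by simp) ⟨_, Or.inl h⟩
  · intro h
    refine isRightCancelMul_of_letters fun a x y hxy => ?_
    obtain ⟨n, hn⟩ := (conGen_iff_deriv hE.symm).1 hxy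
    obtain ⟨m, -, hm⟩ := Deriv.cancel_letter_right hC.noThreePieces hE.trans h (a := a) hn
    exact (conGen_iff_deriv hE.symm).2 ⟨m, hm⟩

theorem isCancelMul_iff (hC : IsC 4 R) (hE : IsEquivalencePresentation R) :
    IsCancelMul (PresentedMonoid R) ↔ NoCommonFirstLetter R ∧ NoCommonLastLetter R := by
  rw [← isLeftCancelMul_iff hC hE, ← isRightCancelMul_iff hC hE]
  exact ⟨fun _ => ⟨inferInstance, inferInstance⟩, fun ⟨_, _⟩ => {}⟩

end PresentedMonoid

end SmallOverlap

namespace SmallOverlap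

open Computability

/-! ### Parallel comparison of two encoded words. -/

section Comparison

/-- How far the comparison of the first letters of two encoded words has come. -/
inductive Status
  | start
  | going
  | same
  | different
  deriving DecidableEq

instance : Fintype Status :=
  ⟨{.start, .going, .same, .different}, fun x => by cases x <;> simp⟩

/-- The status after reading one symbol of each word. -/
def Status.next (x y : Option Γ') : Status → Status
  -- The separate state keeps the leading comma from being taken for the end of the first letter.
  | start => if x = some Γ'.comma ∧ y = some Γ'.comma then going else different
  | going => if x = some Γ'.comma ∧ y = some Γ'.comma then same
      else if x = y then going else different
  | same => same
  | different => different

/-- Reads two strings in parallel, and tells whether they are equal (provided that `e` holds) and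
the final status. -/
def compareStrings : List Γ' → List Γ' → Bool → Status → Bool × Status
  | [], [], e, s => (e, s)
  | x :: k, [], e, s => compareStrings k [] (e && decide (some x = none)) (s.next (some x) none)
  | [], y :: l, e, s => compareStrings [] l (e && decide (none = some y)) (s.next none (some y))
  | x :: k, y :: l, e, s =>
    compareStrings k l (e && decide (some x = some y)) (s.next (some x) (some y))

theorem compareStrings_snd_eq (k l : List Γ') (e e' : Bool) (s : Status) :
    (compareStrings k l e s).2 = (compareStrings k l e' s).2 := by
  fun_induction compareStrings k l e s generalizing e' with
  | case1 => rw [compareStrings]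
  | case2 _ _ _ _ ih => exact (ih _).trans (by rw [compareStrings])
  | case3 _ _ _ _ ih => exact (ih _).trans (by rw [compareStrings])
  | case4 _ _ _ _ _ _ ih => exact (ih _).trans (by rw [compareStrings])

/-- Whether two words that have been compared agree in their first letter, but are different. -/
def clash (c : Bool × Status) : Bool := decide (c.2 = .same) && !c.1

theorem compareStrings_fst (k l : List Γ') (e : Bool) (s : Status) :
    (compareStrings k l e s).1 = (e && decide (k = l)) := by
  fun_induction compareStrings k l e s with
  | case1 => simp
  | case2 _ _ _ _ ih => rw [ih]; simp
  | case3 _ _ _ _ ih => rw [ih]; simp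
  | case4 _ _ _ _ _ _ ih => rw [ih]; simp [Bool.and_assoc]

theorem compareStrings_snd_of_next {s : Status} (hs : ∀ x y, s.next x y = s) (k l : List Γ')
    (e : Bool) : (compareStrings k l e s).2 = s := by
  fun_induction compareStrings k l e s <;> grind

theorem compareStrings_same (k l : List Γ') (e : Bool) :
    (compareStrings k l e .same).2 = .same :=
  compareStrings_snd_of_next (fun _ _ => rfl) k l e

theorem compareStrings_different (k l : List Γ') (e : Bool) :
    (compareStrings k l e .different).2 = .different :=
  compareStrings_snd_of_next (fun _ _ => rfl) k l e

/-- The comma ends a letter, so a letter that is a proper prefix of the other is detected as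
different. -/
theorem compareStrings_going (X Y : List Γ') : ∀ (a b : List Bool) (e : Bool),
    (compareStrings (a.map Γ'.bit ++ Γ'.comma :: X) (b.map Γ'.bit ++ Γ'.comma :: Y) e .going).2 =
      .same ↔ a = b
  | [], [], e => by simp [compareStrings, Status.next, compareStrings_same]
  | [], _ :: _, e => by simp [compareStrings, Status.next, compareStrings_different]
  | _ :: _, [], e => by simp [compareStrings, Status.next, compareStrings_different]
  | x :: a, y :: b, e => by
    by_cases h : x = y
    · simp [compareStrings, Status.next, h, compareStrings_going X Y a b]
    · simp [compareStrings, Status.next, h, compareStrings_different]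

theorem compareStrings_going_nil (X : List Γ') : ∀ (a : List Bool) (e : Bool),
    (compareStrings (a.map Γ'.bit ++ Γ'.comma :: X) [] e .going).2 = .different
  | [], e => by simp [compareStrings, Status.next, compareStrings_different]
  | x :: a, e => by simp [compareStrings, Status.next, compareStrings_different]

theorem compareStrings_nil_going (X : List Γ') : ∀ (a : List Bool) (e : Bool),
    (compareStrings [] (a.map Γ'.bit ++ Γ'.comma :: X) e .going).2 = .different
  | [], e => by simp [compareStrings, Status.next, compareStrings_different]
  | x :: a, e => by simp [compareStrings, Status.next, compareStrings_different]

/-- A sequence of strings of bits, with a comma before, between and after the strings. -/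
def withCommas (u : List (List Bool)) : List Γ' :=
  Γ'.comma :: u.flatMap fun a => a.map Γ'.bit ++ [Γ'.comma]

theorem withCommas_append (u : List (List Bool)) (a : List Bool) :
    withCommas (u ++ [a]) = withCommas u ++ (a.map Γ'.bit ++ [Γ'.comma]) := by
  simp [withCommas]

theorem withCommas_cons (a : List Bool) (u : List (List Bool)) :
    withCommas (a :: u) = Γ'.comma :: (a.map Γ'.bit ++ withCommas u) := by
  simp [withCommas]

/-- The comma in front makes the format symmetric, so the comparison of first letters, run on
reversed strings, compares last letters. -/
theorem withCommas_reverse (u : List (List Bool)) :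
    (withCommas u).reverse = withCommas (u.reverse.map List.reverse) := by
  induction u with
  | nil => rfl
  | cons a u ih =>
    rw [List.reverse_cons, List.map_append, List.map_singleton, withCommas_append, ← ih,
      withCommas_cons]
    simp

theorem compareStrings_withCommas (u v : List (List Bool)) (e : Bool) :
    (compareStrings (withCommas u) (withCommas v) e .start).2 = .same ↔
      ∃ a r s, u = a :: r ∧ v = a :: s := by
  have h : compareStrings (withCommas u) (withCommas v) e .start =
      compareStrings (withCommas u).tail (withCommas v).tail (e && decide True) .going := by
    simp [withCommas, compareStrings, Status.next]
  rw [h]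
  rcases u with _ | ⟨a, u⟩ <;> rcases v with _ | ⟨b, v⟩
  · simp [withCommas, compareStrings]
  · simp [withCommas, compareStrings_nil_going]
  · simp [withCommas, compareStrings_going_nil]
  · rw [withCommas_cons, withCommas_cons, List.tail_cons, List.tail_cons, withCommas, withCommas,
      compareStrings_going]
    simp [eq_comm]

theorem withCommas_injective : Function.Injective withCommas := by
  intro u
  induction u with
  | nil =>
    rintro (_ | ⟨b, v⟩) h
    · rfl
    · rcases b with _ | _ <;> simp [withCommas] at h
  | cons a u ih =>
    rintro (_ | ⟨b, v⟩) h
    · rcases a with _ | _ <;> simp [withCommas] at h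
    · rw [withCommas_cons, withCommas_cons, List.cons.injEq, withCommas, withCommas] at h
      obtain ⟨rfl, h2⟩ := map_bit_append_comma_inj h.2
      exact congrArg _ (ih (congrArg (List.cons Γ'.comma) h2))

end Comparison

/-! ### The stack program and its running time. -/

section Machine

open Turing

/-- The contents of the machine. -/
inductive StackName
  | input
  | left
  | right
  | left'
  | right'
  | output
  deriving DecidableEq

instance : Fintype StackName :=
  ⟨{.input, .left, .right, .left', .right', .output}, fun x => by cases x <;> simp⟩

/-- The alphabets of the contents. -/
abbrev StackSymbol : StackName → Type
  | .output => Bool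
  | _ => Γ'

/-- The labels of the program. -/
inductive Label
  | number
  | relation
  | readLeft
  | readRight
  | back
  | forth
  deriving DecidableEq

instance : Fintype Label :=
  ⟨{.number, .relation, .readLeft, .readRight, .back, .forth}, fun x => by cases x <;> simp⟩

/-- The internal state: two symbols read, the state of a comparison, and the answers so far. -/
structure Register where
  x : Option Γ'
  y : Option Γ'
  isEqual : Bool
  status : Status
  answers : Bool × Bool
  deriving DecidableEq, Fintype

namespace Register

/-- The internal state between two jumps. -/
def rest (e : Bool) (s : Status) (b : Bool × Bool) : Register := ⟨none, none, e, s, b⟩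

def setX (r : Register) (x : Option Γ') : Register := { r with x := x }

def setY (r : Register) (y : Option Γ') : Register := { r with y := y }

def clear (r : Register) : Register := { r with x := none, y := none }

def reset (r : Register) : Register := rest true .start r.answers

def compare (r : Register) : Register :=
  { r with isEqual := r.isEqual && decide (r.x = r.y), status := r.status.next r.x r.y }

def concludeLast (r : Register) : Register :=
  rest r.isEqual .start (r.answers.1, r.answers.2 && !clash (r.isEqual, r.status))

def concludeFirst (r : Register) : Register :=
  rest true .start (r.answers.1 && !clash (r.isEqual, r.status), r.answers.2)

end Register

open TM2.Stmt in
/-- The program: it reads a relation, compares the reversed words while copying them to two other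
stacks, compares the words, and goes to the next relation. -/
def program : Label → TM2.Stmt StackSymbol Label Register
  | .number => pop .input .setX <|
      branch (fun r => r.x = some Γ'.comma)
        (load .clear <| goto fun _ => .relation)
        (load .clear <| goto fun _ => .number)
  | .relation => pop .input .setX <|
      branch (fun r => r.x.isNone)
        (push .output (fun r => r.answers.1 && r.answers.2) <|
          -- The answers are pushed in reverse order, so that the first one ends on top. The final
          -- `load` restores the initial state, as `haltList` demands.
          push .output (fun r => r.answers.2) <|
          push .output (fun r => r.answers.1) <|
          load (fun _ => .rest true .start (true, true)) halt)
        (push .left (fun _ => Γ'.comma) <| load .clear <| goto fun _ => .readLeft)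
  | .readLeft => pop .input .setX <|
      branch (fun r => r.x = some Γ'.ket)
        -- This second `pop` discards the opening bracket of the right-hand word.
        (pop .input .setX <| push .right (fun _ => Γ'.comma) <|
          load .clear <| goto fun _ => .readRight)
        -- `Γ'.blank` is a mere default: on an encoding, the input does not run out before the
        -- closing bracket.
        (push .left (fun r => r.x.getD Γ'.blank) <| load .clear <| goto fun _ => .readLeft)
  | .readRight => pop .input .setX <|
      branch (fun r => r.x = some Γ'.ket)
        (load .reset <| goto fun _ => .back)
        (push .right (fun r => r.x.getD Γ'.blank) <| load .clear <| goto fun _ => .readRight)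
  | .back => pop .left .setX <| pop .right .setY <|
      branch (fun r => r.x.isNone && r.y.isNone)
        (load .concludeLast <| goto fun _ => .forth) <|
        branch (fun r => r.x.isNone)
          (push .right' (fun r => r.y.getD Γ'.blank) <|
            load .compare <| load .clear <| goto fun _ => .back) <|
          push .left' (fun r => r.x.getD Γ'.blank) <|
          branch (fun r => r.y.isNone)
            (load .compare <| load .clear <| goto fun _ => .back)
            (push .right' (fun r => r.y.getD Γ'.blank) <|
              load .compare <| load .clear <| goto fun _ => .back)
  | .forth => pop .left' .setX <| pop .right' .setY <|
      branch (fun r => r.x.isNone && r.y.isNone)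
        (load .concludeFirst <| goto fun _ => .relation)
        (load .compare <| load .clear <| goto fun _ => .forth)

/-- The contents of all stacks. -/
def contents (i l r l' r' : List Γ') (o : List Bool) : ∀ k, List (StackSymbol k)
  | .input => i
  | .left => l
  | .right => r
  | .left' => l'
  | .right' => r'
  | .output => o

/-- The configuration at a label, when nothing has been output yet. -/
def config (a : Label) (e : Bool) (s : Status) (b : Bool × Bool) (i l r l' r' : List Γ') :
    TM2.Cfg StackSymbol Label Register :=
  ⟨some a, .rest e s b, contents i l r l' r' []⟩

section Update

variable (i l r l' r' x : List Γ') (o z : List Bool)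

theorem update_contents_input : Function.update (contents i l r l' r' o) .input x =
    contents x l r l' r' o := by funext k; cases k <;> rfl

theorem update_contents_left : Function.update (contents i l r l' r' o) .left x =
    contents i x r l' r' o := by funext k; cases k <;> rfl

theorem update_contents_right : Function.update (contents i l r l' r' o) .right x =
    contents i l x l' r' o := by funext k; cases k <;> rfl

theorem update_contents_left' : Function.update (contents i l r l' r' o) .left' x =
    contents i l r x r' o := by funext k; cases k <;> rfl

theorem update_contents_right' : Function.update (contents i l r l' r' o) .right' x =
    contents i l r l' x o := by funext k; cases k <;> rfl

theorem update_contents_output : Function.update (contents i l r l' r' o) .output z =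
    contents i l r l' r' z := by funext k; cases k <;> rfl

end Update

/-- The program gets from one configuration to another in at most `n` steps. -/
def Runs (n : ℕ) (c d : TM2.Cfg StackSymbol Label Register) : Prop :=
  Nonempty (StateTransition.EvalsToInTime (TM2.step program) c (some d) n)

theorem Runs.trans {m n k : ℕ} {c d e : TM2.Cfg StackSymbol Label Register}
    (h : Runs m c d) (h' : Runs n d e) (hk : m + n ≤ k) : Runs k c e := by
  obtain ⟨h⟩ := h
  obtain ⟨h'⟩ := h'
  have := h.trans _ _ _ _ _ _ h'
  exact ⟨⟨this.toEvalsTo, this.steps_le_m.trans (by omega)⟩⟩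

theorem Runs.of_step {c d : TM2.Cfg StackSymbol Label Register}
    (h : TM2.step program c = some d) : Runs 1 c d :=
  ⟨⟨⟨1, h⟩, le_rfl⟩⟩

section Runs

variable (i l r l' r' : List Γ') (e : Bool) (s : Status) (b : Bool × Bool)

theorem runs_number (k : List Bool) :
    Runs (k.length + 1) (config .number e s b (k.map Γ'.bit ++ Γ'.comma :: i) l r l' r')
      (config .relation e s b i l r l' r') := by
  induction k with
  | nil =>
    apply Runs.of_step
    simp [config, program, contents, update_contents_input, Register.setX, Register.clear,
      Register.rest]
  | cons x k ih =>
    refine Runs.trans (Runs.of_step ?_) ih (by simp; omega)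
    simp [config, program, contents, update_contents_input, Register.setX, Register.clear,
      Register.rest]

theorem runs_relation :
    Runs 1 (config .relation e s b (Γ'.bra :: i) l r l' r')
      (config .readLeft e s b i (Γ'.comma :: l) r l' r') := by
  apply Runs.of_step
  simp [config, program, contents, update_contents_input, update_contents_left, Register.setX,
    Register.clear, Register.rest]

theorem runs_readLeft (k : List Γ') (hk : Γ'.ket ∉ k) :
    Runs (k.length + 1) (config .readLeft e s b (k ++ Γ'.ket :: Γ'.bra :: i) l r l' r')
      (config .readRight e s b i (k.reverse ++ l) (Γ'.comma :: r) l' r') := by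
  induction k generalizing l with
  | nil =>
    apply Runs.of_step
    simp [config, program, contents, update_contents_input, update_contents_right, Register.setX,
      Register.clear, Register.rest]
  | cons x k ih =>
    rw [List.mem_cons, not_or] at hk
    rw [List.reverse_cons, List.append_assoc]
    refine Runs.trans (Runs.of_step ?_) (ih (x :: l) hk.2) (by simp; omega)
    simp [config, program, contents, update_contents_input, update_contents_left, Register.setX,
      Register.clear, Register.rest, Ne.symm hk.1]

theorem runs_readRight (k : List Γ') (hk : Γ'.ket ∉ k) :
    Runs (k.length + 1) (config .readRight e s b (k ++ Γ'.ket :: i) l r l' r')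
      (config .back true .start b i l (k.reverse ++ r) l' r') := by
  induction k generalizing r with
  | nil =>
    apply Runs.of_step
    simp [config, program, contents, update_contents_input, Register.setX, Register.reset,
      Register.rest]
  | cons x k ih =>
    rw [List.mem_cons, not_or] at hk
    rw [List.reverse_cons, List.append_assoc]
    refine Runs.trans (Runs.of_step ?_) (ih (x :: r) hk.2) (by simp; omega)
    simp [config, program, contents, update_contents_input, update_contents_right, Register.setX,
      Register.clear, Register.rest, Ne.symm hk.1]

/-- One step per symbol of the longer stack, and a last one that finds both stacks empty. The
equality flag is passed on to the next comparison. -/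
theorem runs_back :
    Runs (max l.length r.length + 1) (config .back e s b i l r l' r')
      (config .forth (compareStrings l r e s).1 .start
        (b.1, b.2 && !clash (compareStrings l r e s)) i [] []
        (l.reverse ++ l') (r.reverse ++ r')) := by
  fun_induction compareStrings l r e s generalizing l' r' with
  | case1 =>
    apply Runs.of_step
    simp [config, program, contents, update_contents_left, update_contents_right, Register.setX,
      Register.setY, Register.concludeLast, Register.rest]
  | case2 x l e s ih =>
    rw [List.reverse_cons, List.append_assoc]
    refine Runs.trans (Runs.of_step ?_) (ih (x :: l') r') (by simp; omega)
    simp [config, program, contents, update_contents_left, update_contents_right,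
      update_contents_left', update_contents_right', Register.setX, Register.setY,
      Register.compare, Register.clear, Register.rest]
  | case3 y r e s ih =>
    rw [List.reverse_cons, List.append_assoc]
    refine Runs.trans (Runs.of_step ?_) (ih l' (y :: r')) (by simp; omega)
    simp [config, program, contents, update_contents_left, update_contents_right,
      update_contents_left', update_contents_right', Register.setX, Register.setY,
      Register.compare, Register.clear, Register.rest]
  | case4 x l y r e s ih =>
    rw [List.reverse_cons, List.append_assoc, List.reverse_cons, List.append_assoc]
    refine Runs.trans (Runs.of_step ?_) (ih (x :: l') (y :: r')) (by simp; omega)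
    simp [config, program, contents, update_contents_left, update_contents_right,
      update_contents_left', update_contents_right', Register.setX, Register.setY,
      Register.compare, Register.clear, Register.rest]

theorem runs_forth :
    Runs (max l'.length r'.length + 1) (config .forth e s b i l r l' r')
      (config .relation true .start
        (b.1 && !clash (compareStrings l' r' e s), b.2) i l r [] []) := by
  fun_induction compareStrings l' r' e s with
  | case1 =>
    apply Runs.of_step
    simp [config, program, contents, update_contents_left', update_contents_right', Register.setX,
      Register.setY, Register.concludeFirst, Register.rest]
  | case2 x l' e s ih =>
    refine Runs.trans (Runs.of_step ?_) ih (by simp; omega)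
    simp [config, program, contents, update_contents_left', update_contents_right', Register.setX,
      Register.setY, Register.compare, Register.clear, Register.rest]
  | case3 y r' e s ih =>
    refine Runs.trans (Runs.of_step ?_) ih (by simp; omega)
    simp [config, program, contents, update_contents_left', update_contents_right', Register.setX,
      Register.setY, Register.compare, Register.clear, Register.rest]
  | case4 x l' y r' e s ih =>
    refine Runs.trans (Runs.of_step ?_) ih (by simp; omega)
    simp [config, program, contents, update_contents_left', update_contents_right', Register.setX,
      Register.setY, Register.compare, Register.clear, Register.rest]

theorem runs_finish :
    Runs 1 (config .relation e s b [] [] [] [] [])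
      ⟨none, .rest true .start (true, true),
        contents [] [] [] [] [] (encodeAnswers (b.1, b.2, b.1 && b.2))⟩ := by
  apply Runs.of_step
  simp [config, program, contents, update_contents_input, update_contents_output, Register.setX,
    Register.rest, encodeAnswers]

end Runs

end Machine

end SmallOverlap

namespace SmallOverlap

open Computability Turing

/-! ### Correctness of the answers and the polynomial time bound. -/

section Correctness

variable {n : ℕ}

/-- The letters of a word in binary. -/
def binaryLetters (w : FreeMonoid (Fin n)) : List (List Bool) :=
  w.toList.map fun a : Fin n => encodeNat a

theorem encodeNat_fin_injective : Function.Injective fun a : Fin n => encodeNat a := by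
  intro a b h
  exact Fin.ext (by simpa using congrArg decodeNat h)

theorem binaryLetters_injective : Function.Injective (binaryLetters (n := n)) :=
  (List.map_injective_iff.2 encodeNat_fin_injective).comp FreeMonoid.toList.injective

/-- The string between the brackets of an encoded word. -/
def encodeLetters (w : FreeMonoid (Fin n)) : List Γ' :=
  w.toList.flatMap fun a : Fin n => encodeNumber a

theorem encodeWord_eq (w : FreeMonoid (Fin n)) :
    encodeWord w = Γ'.bra :: (encodeLetters w ++ [Γ'.ket]) := rfl

theorem ket_notMem_encodeLetters (w : FreeMonoid (Fin n)) : Γ'.ket ∉ encodeLetters w := by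
  simp [encodeLetters, encodeNumber]

theorem comma_cons_encodeLetters (w : FreeMonoid (Fin n)) :
    Γ'.comma :: encodeLetters w = withCommas (binaryLetters w) := by
  simp [encodeLetters, withCommas, binaryLetters, List.flatMap_map, encodeNumber]

/-- Whether a relation is not of the form `(a r, a s)` with `r ≠ s`. -/
def firstAnswer (r : FreeMonoid (Fin n) × FreeMonoid (Fin n)) : Bool :=
  !clash (compareStrings (withCommas (binaryLetters r.1)) (withCommas (binaryLetters r.2))
    true .start)

/-- Whether a relation is not of the form `(r a, s a)` with `r ≠ s`. -/
def lastAnswer (r : FreeMonoid (Fin n) × FreeMonoid (Fin n)) : Bool :=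
  !clash (compareStrings (withCommas (binaryLetters r.1)).reverse
    (withCommas (binaryLetters r.2)).reverse true .start)

theorem not_clash_iff (c : Bool × Status) : (!clash c) = true ↔ (c.2 = .same → c.1 = true) := by
  simp [clash, imp_iff_not_or]

theorem firstAnswer_iff (u v : FreeMonoid (Fin n)) :
    firstAnswer (u, v) = true ↔ ∀ a r s, u = .of a * r → v = .of a * s → r = s := by
  rw [firstAnswer, not_clash_iff, compareStrings_fst, compareStrings_withCommas]
  simp only [Bool.true_and, decide_eq_true_eq, withCommas_injective.eq_iff,
    binaryLetters_injective.eq_iff]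
  constructor
  · rintro h a r s rfl rfl
    exact mul_left_cancel (h ⟨encodeNat a, binaryLetters r, binaryLetters s, rfl, rfl⟩)
  · rintro h ⟨a, r, s, hu, hv⟩
    obtain ⟨a₁, r', hu', ha₁, -⟩ := List.map_eq_cons_iff.1 hu
    obtain ⟨a₂, s', hv', ha₂, -⟩ := List.map_eq_cons_iff.1 hv
    obtain rfl : a₁ = a₂ := encodeNat_fin_injective (ha₁.trans ha₂.symm)
    have hu'' : u = .of a₁ * .ofList r' := FreeMonoid.toList.injective hu'
    have hv'' : v = .of a₁ * .ofList s' := FreeMonoid.toList.injective hv'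
    rw [hu'', hv'', h a₁ _ _ hu'' hv'']

theorem lastAnswer_iff (u v : FreeMonoid (Fin n)) :
    lastAnswer (u, v) = true ↔ ∀ a r s, u = r * .of a → v = s * .of a → r = s := by
  rw [lastAnswer, not_clash_iff, compareStrings_fst, withCommas_reverse, withCommas_reverse,
    compareStrings_withCommas]
  simp only [Bool.true_and, decide_eq_true_eq, withCommas_injective.eq_iff,
    (List.map_injective_iff.2 List.reverse_injective).eq_iff, List.reverse_injective.eq_iff,
    binaryLetters_injective.eq_iff]
  constructor
  · rintro h a r s rfl rfl
    refine mul_right_cancel (h ⟨(encodeNat a).reverse,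
      (binaryLetters r).reverse.map List.reverse, (binaryLetters s).reverse.map List.reverse,
      ?_, ?_⟩) <;> simp [binaryLetters, FreeMonoid.toList_mul]
  · rintro h ⟨a, r, s, hu, hv⟩
    obtain ⟨b₁, r₁, hu, hb₁, -⟩ := List.map_eq_cons_iff.1 hu
    obtain ⟨b₂, s₁, hv, hb₂, -⟩ := List.map_eq_cons_iff.1 hv
    rw [binaryLetters, ← List.map_reverse] at hu hv
    obtain ⟨a₁, r', hu', ha₁, -⟩ := List.map_eq_cons_iff.1 hu
    obtain ⟨a₂, s', hv', ha₂, -⟩ := List.map_eq_cons_iff.1 hv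
    obtain rfl : b₁ = b₂ := List.reverse_injective (hb₁.trans hb₂.symm)
    obtain rfl : a₁ = a₂ := encodeNat_fin_injective (ha₁.trans ha₂.symm)
    rw [List.reverse_eq_iff, List.reverse_cons] at hu' hv'
    have hu'' : u = .ofList r'.reverse * .of a₁ := FreeMonoid.toList.injective hu'
    have hv'' : v = .ofList s'.reverse * .of a₁ := FreeMonoid.toList.injective hv'
    rw [hu'', hv'', h a₁ _ _ hu'' hv'']

/-- Reading costs one step for each symbol of the words, and each of the two comparisons costs the
length of the longer word. This is at most three times the total length plus a constant, which the
four brackets absorb. -/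
theorem runs_oneRelation (b : Bool × Bool) (i : List Γ')
    (r : FreeMonoid (Fin n) × FreeMonoid (Fin n)) :
    Runs (4 * (encodeRelation r).length)
      (config .relation true .start b (encodeRelation r ++ i) [] [] [] [])
      (config .relation true .start (b.1 && firstAnswer r, b.2 && lastAnswer r) i [] [] [] []) := by
  obtain ⟨u, v⟩ := r
  have hu : (encodeLetters u).reverse ++ [Γ'.comma] = (withCommas (binaryLetters u)).reverse := by
    rw [← comma_cons_encodeLetters, List.reverse_cons]
  have hv : (encodeLetters v).reverse ++ [Γ'.comma] = (withCommas (binaryLetters v)).reverse := by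
    rw [← comma_cons_encodeLetters, List.reverse_cons]
  have hul : (withCommas (binaryLetters u)).length = (encodeLetters u).length + 1 := by
    rw [← comma_cons_encodeLetters, List.length_cons]
  have hvl : (withCommas (binaryLetters v)).length = (encodeLetters v).length + 1 := by
    rw [← comma_cons_encodeLetters, List.length_cons]
  have e : encodeRelation (u, v) ++ i = Γ'.bra :: (encodeLetters u ++ Γ'.ket :: Γ'.bra ::
      (encodeLetters v ++ Γ'.ket :: i)) := by
    simp [encodeRelation, encodeWord_eq]
  have elen : (encodeRelation (u, v)).length =
      (encodeLetters u).length + (encodeLetters v).length + 4 := by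
    simp [encodeRelation, encodeWord_eq]
    omega
  have h1 := runs_relation (encodeLetters u ++ Γ'.ket :: Γ'.bra ::
    (encodeLetters v ++ Γ'.ket :: i)) [] [] [] [] true .start b
  have h2 := runs_readLeft (encodeLetters v ++ Γ'.ket :: i) [Γ'.comma] [] [] [] true .start b
    (encodeLetters u) (ket_notMem_encodeLetters u)
  have h3 := runs_readRight i ((encodeLetters u).reverse ++ [Γ'.comma]) [Γ'.comma] [] []
    true .start b (encodeLetters v) (ket_notMem_encodeLetters v)
  rw [hu, hv] at h3
  rw [hu] at h2
  have h4 := runs_back i (withCommas (binaryLetters u)).reverse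
    (withCommas (binaryLetters v)).reverse [] [] true .start b
  have h5 := runs_forth i [] [] (withCommas (binaryLetters u)) (withCommas (binaryLetters v))
    (compareStrings (withCommas (binaryLetters u)).reverse
      (withCommas (binaryLetters v)).reverse true .start).1 .start
    (b.1, b.2 && lastAnswer (u, v))
  simp only [List.append_nil, List.reverse_reverse] at h4
  -- The second comparison inherits the equality flag of the first. This is harmless: two strings
  -- are equal exactly if their reverses are, and the status ignores the flag.
  have hfst : (compareStrings (withCommas (binaryLetters u)) (withCommas (binaryLetters v))
      (compareStrings (withCommas (binaryLetters u)).reverse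
        (withCommas (binaryLetters v)).reverse true .start).1 .start) =
      compareStrings (withCommas (binaryLetters u)) (withCommas (binaryLetters v)) true .start := by
    refine Prod.ext ?_ (compareStrings_snd_eq _ _ _ _ _)
    simp only [compareStrings_fst, List.reverse_injective.eq_iff, Bool.true_and, Bool.and_self]
  rw [hfst] at h5
  rw [List.length_reverse, List.length_reverse] at h4
  rw [e, elen]
  refine Runs.trans (((h1.trans h2 le_rfl).trans h3 le_rfl).trans h4 le_rfl) h5 ?_
  omega

theorem runs_relations (R : List (FreeMonoid (Fin n) × FreeMonoid (Fin n))) (b : Bool × Bool) :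
    Runs (4 * (R.flatMap encodeRelation).length)
      (config .relation true .start b (R.flatMap encodeRelation) [] [] [] [])
      (config .relation true .start (b.1 && R.all firstAnswer, b.2 && R.all lastAnswer)
        [] [] [] [] []) := by
  induction R generalizing b with
  | nil => exact ⟨by simpa using StateTransition.EvalsToInTime.refl _ _⟩
  | cons r R ih =>
    rw [List.flatMap_cons]
    refine Runs.trans (runs_oneRelation b _ r) ?_ (by rw [List.length_append, mul_add])
    simpa [Bool.and_assoc] using ih (b.1 && firstAnswer r, b.2 && lastAnswer r)

/-- The answers for a presentation. -/
def answers (P : FinPresentation) : Bool × Bool × Bool :=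
  (P.relations.all firstAnswer, P.relations.all lastAnswer,
    P.relations.all firstAnswer && P.relations.all lastAnswer)

theorem answers_first_iff (P : FinPresentation) :
    (answers P).1 = true ↔ NoCommonFirstLetter P.Rel := by
  simp only [answers, List.all_eq_true, Prod.forall, firstAnswer_iff]
  exact ⟨fun h a r s hrs => h _ _ hrs a r s rfl rfl,
    fun h u v huv a r s hu hv => h a r s (by subst hu hv; exact huv)⟩

theorem answers_last_iff (P : FinPresentation) :
    (answers P).2.1 = true ↔ NoCommonLastLetter P.Rel := by
  simp only [answers, List.all_eq_true, Prod.forall, lastAnswer_iff]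
  exact ⟨fun h a r s hrs => h _ _ hrs a r s rfl rfl,
    fun h u v huv a r s hu hv => h a r s (by subst hu hv; exact huv)⟩

theorem answers_both_iff (P : FinPresentation) :
    (answers P).2.2 = true ↔ NoCommonFirstLetter P.Rel ∧ NoCommonLastLetter P.Rel := by
  rw [← answers_first_iff, ← answers_last_iff]
  exact Bool.and_eq_true_iff

theorem runs_presentation (P : FinPresentation) :
    Runs (4 * (encodePresentation P).length + 2)
      (config .number true .start (true, true) (encodePresentation P) [] [] [] [])
      ⟨none, .rest true .start (true, true),
        contents [] [] [] [] [] (encodeAnswers (answers P))⟩ := by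
  have h1 := runs_number (P.relations.flatMap encodeRelation) [] [] [] [] true .start (true, true)
    (encodeNat P.size)
  have h2 := runs_relations P.relations (true, true)
  have h3 := runs_finish true .start ((true && P.relations.all firstAnswer,
    true && P.relations.all lastAnswer))
  have e : encodePresentation P = (encodeNat P.size).map Γ'.bit ++ Γ'.comma ::
      P.relations.flatMap encodeRelation := by
    simp [encodePresentation, encodeNumber]
  rw [← e] at h1
  refine Runs.trans (h1.trans h2 le_rfl) h3 ?_
  rw [e]
  simp only [List.length_append, List.length_map, List.length_cons]
  omega

/-- The machine with the above program. -/
def machine : FinTM2 where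
  K := StackName
  k₀ := .input
  k₁ := .output
  Γ := StackSymbol
  Λ := Label
  main := .number
  σ := Register
  initialState := .rest true .start (true, true)
  Γk₀Fin := inferInstanceAs (Fintype Γ')
  m := program

/-- It remains to identify `initList` and `haltList` of the machine with the two end configurations
of `runs_presentation`. -/
theorem nonempty_computable_answers :
    Nonempty (TM2ComputableInPolyTime encodePresentation encodeAnswers answers) := by
  refine ⟨⟨⟨machine, Equiv.refl _, Equiv.refl _⟩, 4 * Polynomial.X + 2, fun P => ?_⟩⟩
  have e1 : initList machine ((encodePresentation P).map (Equiv.refl Γ').invFun) =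
      config .number true .start (true, true) (encodePresentation P) [] [] [] [] :=
    congrArg (TM2.Cfg.mk _ _) (by funext k; cases k <;> first | rfl | exact List.map_id _)
  have e2 : haltList machine ((encodeAnswers (answers P)).map (Equiv.refl Bool).invFun) =
      ⟨none, .rest true .start (true, true),
        contents [] [] [] [] [] (encodeAnswers (answers P))⟩ :=
    congrArg (TM2.Cfg.mk _ _) (by funext k; cases k <;> rfl)
  have h := Classical.choice (runs_presentation P)
  exact
    { steps := h.steps
      evals_in_steps := (congrArg (fun c => (flip bind (TM2.step program))^[h.steps] (some c))
        e1).trans (h.evals_in_steps.trans (congrArg some e2.symm))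
      steps_le_m := h.steps_le_m.trans_eq (by simp) }

end Correctness

end SmallOverlap

theorem mainTheorem10 :
    ∃ decision : SmallOverlap.FinPresentation → Bool × Bool × Bool,
      Nonempty (Turing.TM2ComputableInPolyTime SmallOverlap.encodePresentation
        SmallOverlap.encodeAnswers decision) ∧
      (∀ P : SmallOverlap.FinPresentation,
        SmallOverlap.IsC 4 P.Rel → SmallOverlap.IsEquivalencePresentation P.Rel →
          ((decision P).1 = true ↔ IsLeftCancelMul P.PresentedBy) ∧
          ((decision P).2.1 = true ↔ IsRightCancelMul P.PresentedBy) ∧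
          ((decision P).2.2 = true ↔ IsCancelMul P.PresentedBy)) ∧
      (∀ P : SmallOverlap.FinPresentation,
        ((decision P).1 = true ↔ SmallOverlap.NoCommonFirstLetter P.Rel) ∧
        ((decision P).2.1 = true ↔ SmallOverlap.NoCommonLastLetter P.Rel) ∧
        ((decision P).2.2 = true ↔
          SmallOverlap.NoCommonFirstLetter P.Rel ∧ SmallOverlap.NoCommonLastLetter P.Rel)) := by
  refine ⟨SmallOverlap.answers, SmallOverlap.nonempty_computable_answers, fun P hC hE => ?_,
    fun P => ⟨SmallOverlap.answers_first_iff P, SmallOverlap.answers_last_iff P,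
      SmallOverlap.answers_both_iff P⟩⟩
  rw [SmallOverlap.answers_first_iff, SmallOverlap.answers_last_iff,
    SmallOverlap.answers_both_iff]
  exact ⟨(SmallOverlap.isLeftCancelMul_iff hC hE).symm,
    (SmallOverlap.isRightCancelMul_iff hC hE).symm, (SmallOverlap.isCancelMul_iff hC hE).symm⟩
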